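/- Let $F$ be a probability measure on $[0,1]$ (the law of the agent's type $\theta$) and let $\rho$ be a Markov kernel on $[0,1]$ (so $\rho(\cdot\mid\theta)$ is the law of the perception $\pi\in[0,1]$ of an inattentive agent of type $\theta$). Let $F_I=\int\rho(\cdot\mid\theta)\,dF(\theta)$ be the resulting law of inattentive perceptions. A mechanism $\mathcal M=(q,t)$ consists of an allocation rule $q:[0,1]\to[0,1]$ and a transfer rule $t:[0,1]\to\mathbb R$ that are incentive compatible: with $U(\hat\pi\mid\pi)=\pi q(\hat\pi)-t(\hat\pi)$, one has $U(\hat\pi\mid\pi)\le U(\pi\mid\pi)$ for all $\pi,\hat\pi\in[0,1]$. Its value of attention is $$\nu(\mathcal M)=\int_0^1\int_0^1\bigl[U(\theta\mid\theta)-U(\pi\mid\theta)\bigr]\,d\rho(\pi\mid\theta)\,dF(\theta).$$ Let $Q$ be the set of non-decreasing $q:[0,1]\to[0,1]$. Let $Q^*\subseteq Q$ be the set of rules that maximize the value of attention, i.e. $q\in Q^*$ iff $q \in Q$ and some mechanism $(q,t)$ satisfies $\nu(q,t)\ge\nu(q',t')$ for all mechanisms $(q',t')$. A threshold rule is a $q:[0,1]\to[0,1]$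 for which there is $\pi^*\in[0,1]$ with $q(\pi)=1$ for $\pi>\pi^*$, $q(\pi)=0$ for $\pi<\pi^*$ and $q(\pi^*)\in\{0,1\}$. Let $\tau^*$ be the set of threshold rules in $Q^*$, with the $\sigma$-algebra generated by the evaluations $q\mapsto q(x)$, $x\in[0,1]$. **Proposition.** 1. For $q\in Q$: $q\in Q^*$ if and only if there is a probability measure $\lambda$ on $\tau^*$ such that $$q=\int_{\tau^*}q'\,d\lambda(q')$$ as a Bochner integral in $L^1([0,1],\,\mathrm{Leb}+F_I)$ (the integrand $q'\mapsto q'$ being Bochner integrable). 2. For every $q:[0,1]\to[0,1]$: $q\in Q^*$ if and only if there is a probability measure $\lambda$ on $\tau^*$ such that $q(x)=\int_{\tau^*}q'(x)\,d\lambda(q')$ for every $x\in[0,1]$. -/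

import Mathlib

open MeasureTheory ProbabilityTheory unitInterval
open scoped ENNReal

noncomputable section

namespace Attention

/-- Allocation rules `q : [0,1] → [0,1]`, mapping a reported perception to an allocation.
The space carries the product σ-algebra, generated by the evaluations `q ↦ q x`. -/
abbrev AllocationRule : Type := I → I

/-- The perceived utility `U(r | p) = p * q(r) - t(r)` of reporting `r` with perception `p`,
under allocation rule `q` and transfer rule `t`. -/
def utility (q : AllocationRule) (t : I → ℝ) (r p : I) : ℝ :=
  (p : ℝ) * (q r : ℝ) - t r

/-- An incentive-compatible direct-revelation mechanism: reporting the perceived type is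
optimal for every perception. -/
structure Mechanism where
  /-- the allocation rule -/
  q : AllocationRule
  /-- the transfer rule -/
  t : I → ℝ
  /-- incentive compatibility -/
  incentiveCompatible : ∀ p r : I, utility q t r p ≤ utility q t p p

/-- The value of attention of a mechanism, for the type distribution `F` and the
perception-generating process `ρ` (`ρ θ` is the law of the inattentive perception of type `θ`):
`∫ ∫ [U(θ | θ) - U(π | θ)] dρ(π | θ) dF(θ)`. -/
def valueOfAttention (F : Measure I) (ρ : Kernel I I) (M : Mechanism) : ℝ :=
  ∫ θ, ∫ p, (utility M.q M.t θ θ - utility M.q M.t p θ) ∂(ρ θ) ∂F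

/-- The feasible allocation rules: all non-decreasing `q : [0,1] → [0,1]`. -/
def feasible : Set AllocationRule := {q | Monotone q}

/-- The allocation rules that maximize the value of attention: the feasible rules implemented
by an incentive-compatible mechanism whose value of attention is the largest possible. -/
def maximizers (F : Measure I) (ρ : Kernel I I) : Set AllocationRule :=
  {q | q ∈ feasible ∧ ∃ M : Mechanism, M.q = q ∧
    ∀ M' : Mechanism, valueOfAttention F ρ M' ≤ valueOfAttention F ρ M}

/-- Threshold allocation rules: `0` below some threshold, `1` above it, and `0` or `1` at it. -/
def IsThreshold (q : AllocationRule) : Prop :=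
  ∃ c : I, (∀ x, c < x → q x = 1) ∧ (∀ x, x < c → q x = 0) ∧ (q c = 0 ∨ q c = 1)

/-- The threshold rules that maximize the value of attention. -/
def thresholdMaximizers (F : Measure I) (ρ : Kernel I I) : Set AllocationRule :=
  {q | IsThreshold q ∧ q ∈ maximizers F ρ}

/-- The law `F_I` of the inattentive perception: the `π`-marginal of `F(dθ) ρ(dπ | θ)`. -/
def perceptionLaw (F : Measure I) (ρ : Kernel I I) : Measure I := F.bind ρ

/-- Lebesgue measure on `[0,1]` plus the law of the inattentive perception. The value of attention
depends on an allocation rule only up to null sets of this measure. -/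
def refMeasure (F : Measure I) (ρ : Kernel I I) : Measure I := volume + perceptionLaw F ρ

instance (F : Measure I) (ρ : Kernel I I) [IsProbabilityMeasure F] [IsMarkovKernel ρ] :
    IsFiniteMeasure (refMeasure F ρ) := by
  unfold refMeasure perceptionLaw
  infer_instance

theorem memLp_of_feasible (μ : Measure I) [IsFiniteMeasure μ] {q : AllocationRule}
    (hq : q ∈ feasible) : MemLp (fun x => (q x : ℝ)) 1 μ := by
  have hm : Measurable q := Monotone.measurable hq
  refine MemLp.of_bound (measurable_subtype_coe.comp hm).aestronglyMeasurable 1 ?_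
  refine Filter.Eventually.of_forall fun x => ?_
  rw [Real.norm_of_nonneg (q x).2.1]
  exact (q x).2.2

/-- A feasible allocation rule as an element of the Banach space `L¹(refMeasure F ρ)`. -/
def toL1 (F : Measure I) (ρ : Kernel I I) [IsProbabilityMeasure F] [IsMarkovKernel ρ]
    (q : AllocationRule) (hq : q ∈ feasible) : Lp ℝ 1 (refMeasure F ρ) :=
  (memLp_of_feasible (refMeasure F ρ) hq).toLp (fun x => (q x : ℝ))

/-- `q = ∫ q' dΛ(q')` over the threshold maximizers, as a Bochner integral in
`L¹(refMeasure F ρ)`. -/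
def IsBochnerMixture (F : Measure I) (ρ : Kernel I I) [IsProbabilityMeasure F] [IsMarkovKernel ρ]
    (Λ : Measure (thresholdMaximizers F ρ)) (q : AllocationRule) (hq : q ∈ feasible) : Prop :=
  Integrable (fun q' : thresholdMaximizers F ρ => toL1 F ρ q'.1 q'.2.2.1) Λ ∧
    ∫ q' : thresholdMaximizers F ρ, toL1 F ρ q'.1 q'.2.2.1 ∂Λ = toL1 F ρ q hq

/-- `q = ∫ q' dΛ(q')` over the threshold maximizers, at every point of `[0,1]`. -/
def IsPointwiseMixture (F : Measure I) (ρ : Kernel I I)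
    (Λ : Measure (thresholdMaximizers F ρ)) (q : AllocationRule) : Prop :=
  ∀ x : I, (q x : ℝ) = ∫ q' : thresholdMaximizers F ρ, (q'.1 x : ℝ) ∂Λ

end Attention

end

/-! By the envelope formula, incentive compatibility determines transfers from `q` up to a constant,
so the loss of type `θ` from reporting `π` is `∫_π^θ (q(s) - q(π)) ds`. This is linear in `q`, and
its expectation sees `q` only through Lebesgue measure and the law of `π`. Hence the value of
attention is a continuous linear functional `L` on `L¹(refMeasure F ρ)` (`attentionFunctional`), and
`Q*` is the set of its maximizers over monotone rules (`mem_maximizers_iff`).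

The layer-cake identity `q = ∫ 1{q ≥ s} ds` writes a maximizer as a mixture of threshold rules.
Since `L` commutes with the integral and no level rule beats `q`, almost every level rule is itself
a maximizer (`ae_levelRule_mem`); pushing Lebesgue measure forward along `s ↦ 1{q ≥ s}` gives `λ`.
Conversely, a Bochner mixture of maximizers attains the maximal value of `L`.

The link between the two kinds of mixture is `integral_toL1`: on rules constant between points of a
finite grid, the `L¹` integral reduces to finitely many evaluations, and grids exhausting a dense
sequence that contains all atoms recover every monotone rule in the limit. -/

namespace Attention

open Filter Topology

/-! ### Discretization of monotone rules on finite grids -/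

/-- The largest element of the finite grid `s` below `x`, or `0` if there is none. -/
noncomputable def gridFloor (s : Finset I) (x : I) : I :=
  (s.filter (· ≤ x)).sup id

theorem gridFloor_le (s : Finset I) (x : I) : gridFloor s x ≤ x :=
  Finset.sup_le fun _ hy => (Finset.mem_filter.1 hy).2

theorem le_gridFloor {s : Finset I} {x y : I} (hy : y ∈ s) (hyx : y ≤ x) : y ≤ gridFloor s x :=
  Finset.le_sup (f := id) (Finset.mem_filter.2 ⟨hy, hyx⟩)

theorem gridFloor_mono_right (s : Finset I) : Monotone (gridFloor s) := fun _ _ hxy =>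
  Finset.sup_mono fun _ hz =>
    Finset.mem_filter.2 ⟨(Finset.mem_filter.1 hz).1, (Finset.mem_filter.1 hz).2.trans hxy⟩

/-- The extra point `⊥` is the value of the empty supremum, taken when no grid point lies below `x`.
-/
theorem gridFloor_mem (s : Finset I) (x : I) : gridFloor s x ∈ insert ⊥ s := by
  rcases (s.filter (· ≤ x)).eq_empty_or_nonempty with h | h
  · simp [gridFloor, h]
  · obtain ⟨y, hy, e⟩ := Finset.exists_mem_eq_sup _ h (id : I → I)
    rw [gridFloor, e]
    exact Finset.mem_insert_of_mem (Finset.mem_filter.1 hy).1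

theorem gridFloor_eq_self {s : Finset I} {x : I} (hx : x ∈ s) : gridFloor s x = x :=
  le_antisymm (gridFloor_le s x) (le_gridFloor hx le_rfl)

/-- The first `n` points of a sequence in the unit interval. -/
noncomputable def initialGrid (d : ℕ → I) (n : ℕ) : Finset I := (Finset.range n).image d

theorem mem_initialGrid {d : ℕ → I} {k n : ℕ} (h : k < n) : d k ∈ initialGrid d n :=
  Finset.mem_image_of_mem d (Finset.mem_range.2 h)

theorem tendsto_gridFloor {d : ℕ → I} (hd : DenseRange d) (x : I) :
    Tendsto (fun n => gridFloor (initialGrid d n) x) atTop (𝓝 x) := by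
  refine tendsto_order.2 ⟨fun y hy => ?_, fun y hy => Eventually.of_forall fun n =>
    (gridFloor_le _ x).trans_lt hy⟩
  obtain ⟨k, hk⟩ := hd.exists_mem_open isOpen_Ioo (Set.nonempty_Ioo.2 hy)
  filter_upwards [eventually_gt_atTop k] with n hn
  exact hk.1.trans_le (le_gridFloor (mem_initialGrid hn) hk.2.le)

/-- A sequence that is dense and visits every atom of `μ`. -/
theorem exists_denseRange_atoms (μ : Measure I) [IsFiniteMeasure μ] :
    ∃ d : ℕ → I, DenseRange d ∧ ∀ x ∉ Set.range d, μ {x} = 0 := by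
  have hc : {x : I | 0 < μ {x}}.Countable := by
    refine Measure.countable_meas_pos_of_disjoint_of_meas_iUnion_ne_top μ
      (As := fun x : I => {x}) (fun x => measurableSet_singleton x) ?_ (measure_ne_top _ _)
    exact fun x y hxy => Set.disjoint_singleton.2 hxy
  obtain ⟨D, hD, hDd⟩ := TopologicalSpace.exists_countable_dense I
  obtain ⟨d, hd⟩ := (hD.union hc).exists_eq_range (hDd.nonempty.mono Set.subset_union_left)
  refine ⟨d, ?_, fun x hx => ?_⟩
  · rw [DenseRange, ← hd]
    exact hDd.mono Set.subset_union_left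
  · rw [← hd] at hx
    by_contra h
    exact hx (Or.inr (pos_iff_ne_zero.2 h))

/-- A monotone rule has countably many discontinuities. Those outside the sequence are not atoms, so
together they are null; at a point of the sequence the grid value is eventually exact. -/
theorem ae_tendsto_comp_gridFloor (μ : Measure I) {d : ℕ → I} (hd : DenseRange d)
    (hμ : ∀ x ∉ Set.range d, μ {x} = 0) {q : AllocationRule} (hq : q ∈ feasible) :
    ∀ᵐ x ∂μ, Tendsto (fun n => q (gridFloor (initialGrid d n) x)) atTop (𝓝 (q x)) := by
  have hq' : Monotone q := hq
  have h0 : μ ({x | ¬ ContinuousAt q x} \ Set.range d) = 0 :=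
    (measure_null_iff_singleton (hq'.countable_not_continuousAt.mono Set.sdiff_subset)).2
      fun x hx => hμ x hx.2
  filter_upwards [measure_eq_zero_iff_ae_notMem.1 h0] with x hx
  by_cases hxd : x ∈ Set.range d
  · obtain ⟨k, rfl⟩ := hxd
    refine tendsto_const_nhds.congr' ?_
    filter_upwards [eventually_gt_atTop k] with n hn
    rw [gridFloor_eq_self (mem_initialGrid hn)]
  · have hc : ContinuousAt q x := by
      by_contra h
      exact hx ⟨h, hxd⟩
    exact hc.tendsto.comp (tendsto_gridFloor hd x)

theorem comp_gridFloor_feasible (s : Finset I) {q : AllocationRule} (hq : q ∈ feasible) :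
    (fun x => q (gridFloor s x)) ∈ feasible :=
  fun _ _ hxy => hq (gridFloor_mono_right s hxy)

theorem sum_toLp {α ι E : Type*} [MeasurableSpace α] [NormedAddCommGroup E] {p : ℝ≥0∞}
    {μ : Measure α} (s : Finset ι) {f : ι → α → E} (hf : ∀ i, MemLp (f i) p μ) :
    ∑ i ∈ s, (hf i).toLp (f i) =
      (memLp_finsetSum' s fun i _ => hf i).toLp (∑ i ∈ s, f i) := by
  classical
  induction s using Finset.induction_on with
  | empty => simp only [Finset.sum_empty]; exact (MemLp.toLp_zero _).symm
  | insert a s ha ih => simp only [Finset.sum_insert ha, ih]; exact (MemLp.toLp_add _ _).symm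

/-! ### Allocation rules in `L¹` and their mixtures -/

section L1

variable (F : Measure I) (ρ : Kernel I I) [IsProbabilityMeasure F] [IsMarkovKernel ρ]

theorem tendsto_toL1 {u : ℕ → AllocationRule} {q : AllocationRule} (hu : ∀ n, u n ∈ feasible)
    (hq : q ∈ feasible) (h : ∀ᵐ x ∂refMeasure F ρ, Tendsto (fun n => u n x) atTop (𝓝 (q x))) :
    Tendsto (fun n => toL1 F ρ (u n) (hu n)) atTop (𝓝 (toL1 F ρ q hq)) := by
  rw [tendsto_iff_edist_tendsto_0]
  have e : ∀ n, edist (toL1 F ρ (u n) (hu n)) (toL1 F ρ q hq)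
      = ∫⁻ x, edist (u n x : ℝ) (q x : ℝ) ∂refMeasure F ρ := fun n =>
    Integrable.edist_toL1_toL1 _ _ (memLp_one_iff_integrable.1 (memLp_of_feasible _ (hu n)))
      (memLp_one_iff_integrable.1 (memLp_of_feasible _ hq))
  simp only [e]
  have hm : ∀ {p : AllocationRule}, p ∈ feasible → Measurable fun x => (p x : ℝ) := fun hp =>
    measurable_subtype_coe.comp (Monotone.measurable hp)
  have := tendsto_lintegral_of_dominated_convergence (μ := refMeasure F ρ)
    (F := fun n x => edist (u n x : ℝ) (q x : ℝ)) (f := fun _ => 0) (fun _ => 1)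
    (fun n => (hm (hu n)).edist (hm hq)) (fun n => Eventually.of_forall fun x => ?_)
    (by simp [measure_ne_top]) ?_
  · simpa using this
  · beta_reduce
    rw [edist_dist, Real.dist_eq]
    refine ENNReal.ofReal_le_one.2 (abs_le.2 ⟨?_, ?_⟩) <;>
      linarith [(u n x).2.1, (u n x).2.2, (q x).2.1, (q x).2.2]
  · filter_upwards [h] with x hx
    have := ((continuous_subtype_val.tendsto _).comp hx).edist
      (tendsto_const_nhds (x := ((q x : I) : ℝ)))
    simpa using this

theorem norm_toL1_le (q : AllocationRule) (hq : q ∈ feasible) :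
    ‖toL1 F ρ q hq‖ ≤ (refMeasure F ρ).real Set.univ := by
  have e : ‖toL1 F ρ q hq‖ = (∫⁻ x, ‖(q x : ℝ)‖ₑ ∂refMeasure F ρ).toReal :=
    
    Integrable.norm_toL1_eq_lintegral_enorm _ (memLp_one_iff_integrable.1 (memLp_of_feasible _ hq))
  rw [e, Measure.real]
  refine ENNReal.toReal_mono (measure_ne_top _ _) ?_
  rw [← lintegral_one]
  refine lintegral_mono fun x => ?_
  rw [Real.enorm_of_nonneg (q x).2.1]
  exact ENNReal.ofReal_le_one.2 (q x).2.2

/-- The indicators on the right do not depend on `q`, so measurability and integration over families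
of rules reduce to the scalar evaluations `q y`. -/
theorem toL1_comp_gridFloor (s : Finset I) {q : AllocationRule} (hq : q ∈ feasible) :
    toL1 F ρ (fun x => q (gridFloor s x)) (comp_gridFloor_feasible s hq) =
      ∑ y ∈ insert ⊥ s, (q y : ℝ) • indicatorConstLp 1
        ((gridFloor_mono_right s).measurable (measurableSet_singleton y))
        (measure_ne_top (refMeasure F ρ) _) (1 : ℝ) := by
  simp only [indicatorConstLp, ← MemLp.toLp_const_smul]
  rw [toL1, sum_toLp]
  refine MemLp.toLp_congr _ _ (Eventually.of_forall fun x => ?_)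
  simp only [Finset.sum_apply, Pi.smul_apply, smul_eq_mul]
  rw [Finset.sum_eq_single (gridFloor s x)]
  · simp
  · intro y _ hy
    rw [Set.indicator_of_notMem, mul_zero]
    exact fun h => hy (Set.mem_singleton_iff.1 h).symm
  · exact fun h => absurd (gridFloor_mem s x) h

variable {X : Type*} [MeasurableSpace X]

/-- A family of rules with measurable evaluations is strongly measurable as a map into `L¹`. -/
theorem stronglyMeasurable_toL1 {f : X → AllocationRule} (hf : ∀ a, f a ∈ feasible)
    (hm : ∀ x, Measurable fun a => f a x) :
    StronglyMeasurable fun a => toL1 F ρ (f a) (hf a) := by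
  obtain ⟨d, hd, hμ⟩ := exists_denseRange_atoms (refMeasure F ρ)
  refine stronglyMeasurable_of_tendsto (u := atTop) (f := fun n a =>
    toL1 F ρ (fun x => f a (gridFloor (initialGrid d n) x)) (comp_gridFloor_feasible _ (hf a)))
    (fun n => ?_) (tendsto_pi_nhds.2 fun a => tendsto_toL1 F ρ _ _
      (ae_tendsto_comp_gridFloor _ hd hμ (hf a)))
  simp only [toL1_comp_gridFloor F ρ _ (hf _)]
  exact Finset.stronglyMeasurable_fun_sum _ fun y _ =>
    (measurable_subtype_coe.comp (hm y)).stronglyMeasurable.smul_const _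

theorem integrable_toL1 (Λ : Measure X) [IsFiniteMeasure Λ] {f : X → AllocationRule}
    (hf : ∀ a, f a ∈ feasible) (hm : ∀ x, Measurable fun a => f a x) :
    Integrable (fun a => toL1 F ρ (f a) (hf a)) Λ :=
  Integrable.of_bound (stronglyMeasurable_toL1 F ρ hf hm).aestronglyMeasurable _
    (Eventually.of_forall fun a => norm_toL1_le F ρ (f a) (hf a))

/-- A pointwise mixture of rules is a Bochner mixture in `L¹`. -/
theorem integral_toL1 (Λ : Measure X) [IsFiniteMeasure Λ] {f : X → AllocationRule}
    (hf : ∀ a, f a ∈ feasible) (hm : ∀ x, Measurable fun a => f a x) {q : AllocationRule}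
    (hq : q ∈ feasible) (h : ∀ x, (q x : ℝ) = ∫ a, (f a x : ℝ) ∂Λ) :
    ∫ a, toL1 F ρ (f a) (hf a) ∂Λ = toL1 F ρ q hq := by
  obtain ⟨d, hd, hμ⟩ := exists_denseRange_atoms (refMeasure F ρ)
  have key : ∀ n, ∫ a, toL1 F ρ (fun x => f a (gridFloor (initialGrid d n) x))
      (comp_gridFloor_feasible _ (hf a)) ∂Λ =
      toL1 F ρ (fun x => q (gridFloor (initialGrid d n) x)) (comp_gridFloor_feasible _ hq) := by
    intro n
    have hi : ∀ y, Integrable (fun a => (f a y : ℝ)) Λ := fun y =>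
      Integrable.of_bound (measurable_subtype_coe.comp (hm y)).aestronglyMeasurable 1
        (Eventually.of_forall fun a => by
          rw [Real.norm_of_nonneg (f a y).2.1]
          exact (f a y).2.2)
    simp only [toL1_comp_gridFloor F ρ _ (hf _), toL1_comp_gridFloor F ρ _ hq]
    rw [integral_finsetSum _ fun y _ => (hi y).smul_const _]
    refine Finset.sum_congr rfl fun y _ => ?_
    rw [integral_smul_const, h]
  refine tendsto_nhds_unique ?_ (tendsto_toL1 F ρ (fun n =>
    comp_gridFloor_feasible (initialGrid d n) hq) hq (ae_tendsto_comp_gridFloor _ hd hμ hq))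
  simp only [← key]
  refine tendsto_integral_of_dominated_convergence (fun _ => (refMeasure F ρ).real Set.univ)
    (fun n => (integrable_toL1 F ρ Λ (fun a => comp_gridFloor_feasible _ (hf a))
      (fun x => hm _)).aestronglyMeasurable) (integrable_const _)
    (fun n => Eventually.of_forall fun a => norm_toL1_le F ρ _ _)
    (Eventually.of_forall fun a => tendsto_toL1 F ρ _ _
      (ae_tendsto_comp_gridFloor _ hd hμ (hf a)))

end L1

/-! ### The value of attention as a continuous linear functional -/

section Functional

/-- The primitive `x ↦ ∫₀ˣ g`. -/
noncomputable def primitive (g : I → ℝ) (x : I) : ℝ := ∫ s in Set.Iic x, g s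

theorem primitive_congr {g h : I → ℝ} (e : g =ᵐ[volume] h) (x : I) :
    primitive g x = primitive h x :=
  integral_congr_ae (ae_restrict_of_ae e)

theorem measurable_primitive {g : I → ℝ} (hg : StronglyMeasurable g) :
    StronglyMeasurable (primitive g) := by
  -- A fixed domain of integration makes `primitive g` a partial integral of a jointly measurable
  -- function.
  have e : primitive g = fun x => ∫ s, ({p : I × I | p.2 ≤ p.1}.indicator fun p => g p.2) (x, s) := by
    funext x
    rw [primitive, ← integral_indicator measurableSet_Iic]
    rfl
  rw [e]
  exact StronglyMeasurable.integral_prod_right'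
    ((hg.comp_measurable measurable_snd).indicator (measurableSet_le measurable_snd measurable_fst))

theorem abs_primitive_le {g : I → ℝ} (hg : Integrable g) (x : I) :
    |primitive g x| ≤ ∫ s, |g s| :=
  (abs_integral_le_integral_abs).trans
    (setIntegral_le_integral hg.abs (Eventually.of_forall fun _ => abs_nonneg _))

/-- The loss of type `z.1` from reporting `z.2`, up to rents: `∫_{z.2}^{z.1} (g(s) - g(z.2)) ds`. -/
noncomputable def misreportLoss (g : I → ℝ) (z : I × I) : ℝ :=
  primitive g z.1 - primitive g z.2 - ((z.1 : ℝ) - z.2) * g z.2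

theorem volume_le_refMeasure (F : Measure I) (ρ : Kernel I I) :
    (volume : Measure I) ≤ refMeasure F ρ := Measure.le_add_right le_rfl

theorem perceptionLaw_le_refMeasure (F : Measure I) (ρ : Kernel I I) :
    perceptionLaw F ρ ≤ refMeasure F ρ :=
  Measure.le_add_left le_rfl

variable (F : Measure I) (ρ : Kernel I I) [IsProbabilityMeasure F] [IsMarkovKernel ρ]

theorem map_snd_compProd : (F ⊗ₘ ρ).map Prod.snd = perceptionLaw F ρ :=
  Measure.snd_compProd F ρ

theorem integrable_comp_snd {g : I → ℝ} (hg : Integrable g (refMeasure F ρ)) :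
    Integrable (fun z : I × I => g z.2) (F ⊗ₘ ρ) := by
  have := hg.mono_measure (perceptionLaw_le_refMeasure F ρ)
  rw [← map_snd_compProd] at this
  exact this.comp_measurable measurable_snd

/-- The primitives see only Lebesgue classes and the term `g z.2` only the law of perceptions; this
is why `refMeasure` is the sum of the two measures. -/
theorem misreportLoss_congr {g h : I → ℝ} (e : g =ᵐ[refMeasure F ρ] h) :
    misreportLoss g =ᵐ[F ⊗ₘ ρ] misreportLoss h := by
  have e1 : g =ᵐ[volume] h := ae_mono (volume_le_refMeasure F ρ) e
  have e2 : ∀ᵐ x ∂((F ⊗ₘ ρ).map Prod.snd), g x = h x := by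
    rw [map_snd_compProd]
    exact ae_mono (perceptionLaw_le_refMeasure F ρ) e
  filter_upwards [ae_of_ae_map measurable_snd.aemeasurable e2] with z hz
  simp only [misreportLoss, primitive_congr e1, hz]

theorem abs_misreportLoss_le {g : I → ℝ} (hg : Integrable g) (z : I × I) :
    |misreportLoss g z| ≤ 2 * (∫ s, |g s|) + |g z.2| := by
  have h1 := abs_le.1 (abs_primitive_le hg z.1)
  have h2 := abs_le.1 (abs_primitive_le hg z.2)
  have h3 : |((z.1 : ℝ) - z.2) * g z.2| ≤ |g z.2| := by
    rw [abs_mul]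
    refine mul_le_of_le_one_left (abs_nonneg _) (abs_le.2 ⟨?_, ?_⟩) <;>
      linarith [z.1.2.1, z.1.2.2, z.2.2.1, z.2.2.2]
  have h3 := abs_le.1 h3
  refine abs_le.2 ⟨?_, ?_⟩ <;> unfold misreportLoss <;> linarith [h1.1, h1.2, h2.1, h2.2, h3.1, h3.2]

theorem integrable_misreportLoss {g : I → ℝ} (hg : Integrable g (refMeasure F ρ)) :
    Integrable (misreportLoss g) (F ⊗ₘ ρ) := by
  suffices h : Integrable (misreportLoss (hg.1.mk g)) (F ⊗ₘ ρ) from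
    h.congr (misreportLoss_congr F ρ hg.1.ae_eq_mk.symm)
  have hm := hg.1.stronglyMeasurable_mk
  have hi : Integrable (hg.1.mk g) (refMeasure F ρ) := hg.congr hg.1.ae_eq_mk
  refine Integrable.mono' (((integrable_const _).add (integrable_comp_snd F ρ hi).abs)) ?_
    (Eventually.of_forall fun z =>
      abs_misreportLoss_le (hi.mono_measure (volume_le_refMeasure F ρ)) z)
  have h1 := measurable_primitive hm
  refine StronglyMeasurable.aestronglyMeasurable ?_
  exact ((h1.comp_measurable measurable_fst).sub (h1.comp_measurable measurable_snd)).sub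
    ((Measurable.stronglyMeasurable (by fun_prop)).mul (hm.comp_measurable measurable_snd))

theorem misreportLoss_add {g h : I → ℝ} (hg : Integrable g) (hh : Integrable h) (z : I × I) :
    misreportLoss (g + h) z = misreportLoss g z + misreportLoss h z := by
  have e : ∀ x, primitive (g + h) x = primitive g x + primitive h x := fun x =>
    integral_add hg.integrableOn hh.integrableOn
  simp only [misreportLoss, e, Pi.add_apply]
  ring

theorem misreportLoss_smul (c : ℝ) (g : I → ℝ) (z : I × I) :
    misreportLoss (c • g) z = c * misreportLoss g z := by
  have e : ∀ x, primitive (c • g) x = c * primitive g x := fun x => integral_const_mul c _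
  simp only [misreportLoss, e, Pi.smul_apply, smul_eq_mul]
  ring

/-- The value of attention as a continuous linear functional of the allocation rule. -/
noncomputable def attentionFunctional : Lp ℝ 1 (refMeasure F ρ) →L[ℝ] ℝ :=
  LinearMap.mkContinuous
    { toFun := fun g => ∫ z, misreportLoss g z ∂(F ⊗ₘ ρ)
      map_add' := fun g h => by
        have hg := L1.integrable_coeFn g
        have hh := L1.integrable_coeFn h
        rw [integral_congr_ae (misreportLoss_congr F ρ (Lp.coeFn_add g h)),
          ← integral_add (integrable_misreportLoss F ρ hg) (integrable_misreportLoss F ρ hh)]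
        exact integral_congr_ae (Eventually.of_forall
          (misreportLoss_add (hg.mono_measure (volume_le_refMeasure F ρ))
            (hh.mono_measure (volume_le_refMeasure F ρ))))
      map_smul' := fun c g => by
        rw [integral_congr_ae (misreportLoss_congr F ρ (Lp.coeFn_smul c g)), RingHom.id_apply,
          smul_eq_mul, ← integral_const_mul]
        exact integral_congr_ae (Eventually.of_forall (misreportLoss_smul c g)) }
    -- Each of the two primitives contributes `‖g‖`, and so does the term `g z.2`.
    3 (fun g => by
      have hg := L1.integrable_coeFn g
      have hv := hg.mono_measure (volume_le_refMeasure F ρ)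
      have h1 : ∫ s, |g s| ≤ ‖g‖ := by
        rw [L1.norm_eq_integral_norm]
        exact integral_mono_measure (volume_le_refMeasure F ρ)
          (Eventually.of_forall fun _ => abs_nonneg _) hg.norm
      have h2 : ∫ z : I × I, |g z.2| ∂(F ⊗ₘ ρ) ≤ ‖g‖ := by
        rw [L1.norm_eq_integral_norm]
        have hp := hg.mono_measure (perceptionLaw_le_refMeasure F ρ)
        calc ∫ z : I × I, |g z.2| ∂(F ⊗ₘ ρ) = ∫ x, |g x| ∂((F ⊗ₘ ρ).map Prod.snd) := by
              rw [integral_map measurable_snd.aemeasurable]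
              rw [map_snd_compProd]
              exact hp.abs.1
          _ ≤ _ := by
              rw [map_snd_compProd]
              exact integral_mono_measure (perceptionLaw_le_refMeasure F ρ)
                (Eventually.of_forall fun _ => abs_nonneg _) hg.norm
      have hi := (integrable_comp_snd F ρ hg).abs
      calc ‖∫ z, misreportLoss g z ∂(F ⊗ₘ ρ)‖
          ≤ ∫ z, ‖misreportLoss g z‖ ∂(F ⊗ₘ ρ) := norm_integral_le_integral_norm _
        _ ≤ ∫ z : I × I, (2 * (∫ s, |g s|) + |g z.2|) ∂(F ⊗ₘ ρ) :=
            integral_mono (integrable_misreportLoss F ρ hg).norm ((integrable_const _).add hi)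
              fun z => abs_misreportLoss_le hv z
        _ = 2 * (∫ s, |g s|) + ∫ z : I × I, |g z.2| ∂(F ⊗ₘ ρ) := by
            rw [integral_add (integrable_const _) hi]
            simp
        _ ≤ 3 * ‖g‖ := by linarith)

theorem attentionFunctional_toL1 (q : AllocationRule) (hq : q ∈ feasible) :
    attentionFunctional F ρ (toL1 F ρ q hq) =
      ∫ θ, ∫ p, misreportLoss (fun x => (q x : ℝ)) (θ, p) ∂(ρ θ) ∂F := by
  have h := memLp_one_iff_integrable.1 (memLp_of_feasible (refMeasure F ρ) hq)
  rw [← Measure.integral_compProd (integrable_misreportLoss F ρ h)]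
  exact integral_congr_ae (misreportLoss_congr F ρ (MemLp.coeFn_toLp _))

end Functional

/-! ### Incentive compatibility and the envelope formula -/

section Envelope

/-- On `(r, p]` the integrand lies between `q r` and `q p`. These bounds serve both the envelope
formula and the incentive compatibility of the envelope transfers. -/
theorem mul_le_primitive_sub {q : AllocationRule} (hq : q ∈ feasible) {r p : I} (hrp : r ≤ p) :
    ((p : ℝ) - r) * q r ≤ primitive (fun x => (q x : ℝ)) p - primitive (fun x => (q x : ℝ)) r ∧
    primitive (fun x => (q x : ℝ)) p - primitive (fun x => (q x : ℝ)) r ≤ ((p : ℝ) - r) * q p := by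
  have hi := memLp_one_iff_integrable.1 (memLp_of_feasible volume hq)
  have e : primitive (fun x => (q x : ℝ)) p - primitive (fun x => (q x : ℝ)) r =
      ∫ s in Set.Ioc r p, (q s : ℝ) := by
    rw [primitive, primitive, ← Set.Iic_union_Ioc_eq_Iic hrp, setIntegral_union
      (Set.Iic_disjoint_Ioc le_rfl) measurableSet_Ioc hi.integrableOn hi.integrableOn]
    ring
  have hc : ∀ c : ℝ, ∫ _ in Set.Ioc r p, c = ((p : ℝ) - r) * c := fun c => by
    rw [setIntegral_const, Measure.real, unitInterval.volume_Ioc,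
      ENNReal.toReal_ofReal (sub_nonneg.2 hrp), smul_eq_mul]
  rw [e, ← hc, ← hc]
  exact ⟨setIntegral_mono_on (integrable_const _).integrableOn hi.integrableOn measurableSet_Ioc
      fun x hx => hq hx.1.le,
    setIntegral_mono_on hi.integrableOn (integrable_const _).integrableOn measurableSet_Ioc
      fun x hx => hq hx.2⟩

/-- A function whose increments are bounded by `|p - r| * |q p - q r|` with `q` monotone is
constant. -/
theorem eq_zero_of_abs_sub_le {D : I → ℝ} {q : AllocationRule} (hq : q ∈ feasible)
    (h : ∀ r p : I, r ≤ p → |D p - D r| ≤ ((p : ℝ) - r) * ((q p : ℝ) - q r)) (x : I) :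
    D x = D 0 := by
  have key : ∀ n : ℕ, |D x - D 0| ≤ 1 / ((n : ℝ) + 1) := by
    intro n
    have hn : (0 : ℝ) < (n : ℝ) + 1 := by positivity
    -- Uniform subdivision of `[0, x]` into `n + 1` pieces: the increments of `q` telescope to at
    -- most `1`, leaving only the mesh. The projection is inactive at the indices used.
    set a : ℕ → I := fun k => Set.projIcc 0 1 zero_le_one ((x : ℝ) * (k / ((n : ℝ) + 1))) with ha
    have hmem : ∀ k ≤ n + 1, (a k : ℝ) = (x : ℝ) * (k / ((n : ℝ) + 1)) := by
      intro k hk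
      have hk' : (k : ℝ) ≤ (n : ℝ) + 1 := by exact_mod_cast hk
      have h1 : (k : ℝ) / ((n : ℝ) + 1) ≤ 1 := (div_le_one hn).2 hk'
      have h0 : 0 ≤ (k : ℝ) / ((n : ℝ) + 1) := by positivity
      rw [ha]
      simp only
      rw [Set.projIcc_of_mem _ ⟨mul_nonneg x.2.1 h0, mul_le_one₀ x.2.2 h0 h1⟩]
    have a0 : a 0 = 0 := Subtype.ext (by rw [hmem 0 (by omega)]; simp)
    have aN : a (n + 1) = x := Subtype.ext (by
      rw [hmem _ le_rfl]; push_cast; rw [div_self hn.ne', mul_one])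
    have step : ∀ k ∈ Finset.range (n + 1), |D (a (k + 1)) - D (a k)| ≤
        1 / ((n : ℝ) + 1) * ((q (a (k + 1)) : ℝ) - q (a k)) := by
      intro k hk
      have hk := Finset.mem_range.1 hk
      have e : (a (k + 1) : ℝ) - a k = x / ((n : ℝ) + 1) := by
        rw [hmem _ (by omega), hmem _ (by omega)]
        push_cast
        ring
      have hle : a k ≤ a (k + 1) := by
        rw [← Subtype.coe_le_coe, ← sub_nonneg, e]
        exact div_nonneg x.2.1 hn.le
      refine (h _ _ hle).trans (mul_le_mul_of_nonneg_right ?_ (sub_nonneg.2 (hq hle)))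
      rw [e]
      exact div_le_div_of_nonneg_right x.2.2 hn.le
    calc |D x - D 0| = |∑ k ∈ Finset.range (n + 1), (D (a (k + 1)) - D (a k))| := by
          rw [Finset.sum_range_sub (fun k => D (a k)), a0, aN]
      _ ≤ ∑ k ∈ Finset.range (n + 1), |D (a (k + 1)) - D (a k)| := Finset.abs_sum_le_sum_abs _ _
      _ ≤ ∑ k ∈ Finset.range (n + 1), 1 / ((n : ℝ) + 1) * ((q (a (k + 1)) : ℝ) - q (a k)) :=
          Finset.sum_le_sum step
      _ = 1 / ((n : ℝ) + 1) * ((q x : ℝ) - q 0) := by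
          rw [← Finset.mul_sum, Finset.sum_range_sub (fun k => (q (a k) : ℝ)), a0, aN]
      _ ≤ 1 / ((n : ℝ) + 1) :=
          mul_le_of_le_one_right (by positivity) (by linarith [(q x).2.2, (q 0).2.1])
  have := ge_of_tendsto' tendsto_one_div_add_atTop_nhds_zero_nat key
  exact sub_eq_zero.1 (abs_nonpos_iff.1 this)

theorem Mechanism.monotone (M : Mechanism) : M.q ∈ feasible := by
  intro r p hrp
  rcases hrp.eq_or_lt with rfl | hlt
  · exact le_rfl
  have h1 := M.incentiveCompatible p r
  have h2 := M.incentiveCompatible r p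
  simp only [utility] at h1 h2
  have hlt' : (r : ℝ) < p := hlt
  have : ((p : ℝ) - r) * (M.q r : ℝ) ≤ ((p : ℝ) - r) * (M.q p : ℝ) := by linarith
  exact Subtype.coe_le_coe.1 (le_of_mul_le_mul_left this (sub_pos.2 hlt'))

/-- The envelope formula. -/
theorem Mechanism.utility_eq (M : Mechanism) (p : I) :
    utility M.q M.t p p - primitive (fun x => (M.q x : ℝ)) p =
      utility M.q M.t 0 0 - primitive (fun x => (M.q x : ℝ)) 0 := by
  -- Truthful utility and the primitive both have increments between `(p - r) * q r` and `(p - r) *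
  -- q p`.
  refine eq_zero_of_abs_sub_le
    (D := fun p => utility M.q M.t p p - primitive (fun x => (M.q x : ℝ)) p) M.monotone
    (fun r p hrp => ?_) p
  have h1 := M.incentiveCompatible p r
  have h2 := M.incentiveCompatible r p
  obtain ⟨h3, h4⟩ := mul_le_primitive_sub M.monotone hrp
  simp only [utility] at h1 h2 ⊢
  refine abs_le.2 ⟨?_, ?_⟩ <;> linarith

/-- The envelope formula at `θ` and at `p` carries the same constant rent, which cancels. -/
theorem Mechanism.loss_eq (M : Mechanism) (θ p : I) :
    utility M.q M.t θ θ - utility M.q M.t p θ = misreportLoss (fun x => (M.q x : ℝ)) (θ, p) := by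
  have h1 := M.utility_eq θ
  have h2 := M.utility_eq p
  have h3 : utility M.q M.t p θ = utility M.q M.t p p + ((θ : ℝ) - p) * M.q p := by
    unfold utility
    ring
  simp only [misreportLoss]
  linarith

theorem valueOfAttention_eq (F : Measure I) (ρ : Kernel I I) [IsProbabilityMeasure F]
    [IsMarkovKernel ρ] (M : Mechanism) {q : AllocationRule} (hq : q ∈ feasible) (h : M.q = q) :
    valueOfAttention F ρ M = attentionFunctional F ρ (toL1 F ρ q hq) := by
  subst h
  rw [attentionFunctional_toL1]
  simp only [valueOfAttention, M.loss_eq]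

/-- Every non-decreasing rule is implemented by the envelope transfers. -/
theorem exists_mechanism {q : AllocationRule} (hq : q ∈ feasible) : ∃ M : Mechanism, M.q = q := by
  refine ⟨⟨q, fun p => p * q p - primitive (fun x => (q x : ℝ)) p, fun p r => ?_⟩, rfl⟩
  simp only [utility]
  rcases le_total r p with h | h
  · linarith [(mul_le_primitive_sub hq h).1]
  · linarith [(mul_le_primitive_sub hq h).2]

theorem mem_maximizers_iff (F : Measure I) (ρ : Kernel I I) [IsProbabilityMeasure F]
    [IsMarkovKernel ρ] {q : AllocationRule} (hq : q ∈ feasible) :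
    q ∈ maximizers F ρ ↔ ∀ (q' : AllocationRule) (hq' : q' ∈ feasible),
      attentionFunctional F ρ (toL1 F ρ q' hq') ≤ attentionFunctional F ρ (toL1 F ρ q hq) := by
  constructor
  · rintro ⟨_, M, hM, hmax⟩ q' hq'
    obtain ⟨M', hM'⟩ := exists_mechanism hq'
    rw [← valueOfAttention_eq F ρ M hq hM, ← valueOfAttention_eq F ρ M' hq' hM']
    exact hmax M'
  · intro h
    obtain ⟨M, hM⟩ := exists_mechanism hq
    refine ⟨hq, M, hM, fun M' => ?_⟩
    rw [valueOfAttention_eq F ρ M hq hM, valueOfAttention_eq F ρ M' M'.monotone rfl]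
    exact h _ _

end Envelope

/-! ### Layer-cake decomposition into threshold rules -/

section LayerCake

/-- The upper level set `{q ≥ s}` as an allocation rule. -/
noncomputable def levelRule (q : AllocationRule) (s : I) : AllocationRule :=
  fun x => if s ≤ q x then 1 else 0

theorem levelRule_feasible {q : AllocationRule} (hq : q ∈ feasible) (s : I) :
    levelRule q s ∈ feasible := by
  intro x y hxy
  unfold levelRule
  split_ifs with h1 h2
  · exact le_rfl
  · exact absurd (h1.trans (hq hxy)) h2
  · exact nonneg'
  · exact le_rfl

theorem levelRule_isThreshold {q : AllocationRule} (hq : q ∈ feasible) (s : I) :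
    IsThreshold (levelRule q s) := by
  -- If the level set is empty, the infimum is `1`, and no point lies above it.
  refine ⟨sInf {x | s ≤ q x}, fun x hx => ?_, fun x hx => ?_, ?_⟩
  · obtain ⟨y, hy, hyx⟩ := sInf_lt_iff.1 hx
    exact if_pos (le_trans hy (hq hyx.le))
  · exact if_neg fun h => (sInf_le (a := x) h).not_gt hx
  · unfold levelRule
    split_ifs <;> simp

theorem measurable_levelRule (q : AllocationRule) (x : I) :
    Measurable fun s => levelRule q s x :=
  Measurable.ite measurableSet_Iic measurable_const measurable_const

theorem integral_levelRule (q : AllocationRule) (x : I) :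
    (q x : ℝ) = ∫ s, (levelRule q s x : ℝ) := by
  have e : (fun s => (levelRule q s x : ℝ)) = (Set.Iic (q x)).indicator fun _ => (1 : ℝ) := by
    funext s
    by_cases h : s ≤ q x <;> simp [levelRule, h]
  rw [e, integral_indicator measurableSet_Iic, setIntegral_const, Measure.real,
    unitInterval.volume_Iic, ENNReal.toReal_ofReal (q x).2.1, smul_eq_mul, mul_one]

end LayerCake

/-! ### Mixtures of threshold maximizers -/

theorem measurable_eval_thresholdMaximizers (F : Measure I) (ρ : Kernel I I) (x : I) :
    Measurable fun q' : thresholdMaximizers F ρ => q'.1 x :=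
  (measurable_pi_apply x).comp measurable_subtype_coe

theorem IsPointwiseMixture.feasible (F : Measure I) (ρ : Kernel I I)
    {Λ : Measure (thresholdMaximizers F ρ)} [IsProbabilityMeasure Λ] {q : AllocationRule} (h : IsPointwiseMixture F ρ Λ q) :
    q ∈ feasible := by
  intro x y hxy
  have hi : ∀ y, Integrable (fun q' : thresholdMaximizers F ρ => (q'.1 y : ℝ)) Λ := fun y =>
    Integrable.of_bound (measurable_subtype_coe.comp
      (measurable_eval_thresholdMaximizers F ρ y)).aestronglyMeasurable 1
      (Eventually.of_forall fun a => by
        rw [Real.norm_of_nonneg (a.1 y).2.1]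
        exact (a.1 y).2.2)
  rw [← Subtype.coe_le_coe, h x, h y]
  exact integral_mono (hi x) (hi y) fun q' => q'.2.2.1 hxy

variable (F : Measure I) (ρ : Kernel I I) [IsProbabilityMeasure F] [IsMarkovKernel ρ]

/-- Almost every level rule of a maximizer is a maximizer. -/
theorem ae_levelRule_mem {q : AllocationRule} (hq : q ∈ maximizers F ρ) :
    ∀ᵐ s : I, levelRule q s ∈ thresholdMaximizers F ρ := by
  have hf := hq.1
  have hmax := (mem_maximizers_iff F ρ hf).1 hq
  set L := attentionFunctional F ρ
  have hi := integrable_toL1 F ρ volume (levelRule_feasible hf) (measurable_levelRule q)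
  have e : ∫ s, L (toL1 F ρ (levelRule q s) (levelRule_feasible hf s)) = L (toL1 F ρ q hf) := by
    rw [L.integral_comp_comm hi, integral_toL1 F ρ volume (levelRule_feasible hf)
      (measurable_levelRule q) hf (integral_levelRule q)]
  have hg : Integrable fun s => L (toL1 F ρ q hf) -
      L (toL1 F ρ (levelRule q s) (levelRule_feasible hf s)) :=
    (integrable_const _).sub (L.integrable_comp hi)
  have h0 : ∫ s, (L (toL1 F ρ q hf) -
      L (toL1 F ρ (levelRule q s) (levelRule_feasible hf s))) = 0 := by
    rw [integral_sub (integrable_const _) (L.integrable_comp hi), e]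
    simp
  -- The shortfall from the maximum is nonnegative with zero integral, hence zero almost everywhere.
  have := (integral_eq_zero_iff_of_nonneg (fun s => sub_nonneg.2 (hmax _ _)) hg).1 h0
  filter_upwards [this] with s hs
  refine ⟨levelRule_isThreshold hf s,
    (mem_maximizers_iff F ρ (levelRule_feasible hf s)).2 fun q' hq' => ?_⟩
  rw [← sub_eq_zero.1 hs]
  exact hmax q' hq'

theorem exists_isPointwiseMixture {q : AllocationRule} (hq : q ∈ maximizers F ρ) :
    ∃ Λ : Measure (thresholdMaximizers F ρ),
      IsProbabilityMeasure Λ ∧ IsPointwiseMixture F ρ Λ q := by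
  classical
  have hae := ae_levelRule_mem F ρ hq
  obtain ⟨s₀, hs₀⟩ := hae.exists
  -- The set of bad levels need not be known to be measurable, so it is enlarged to a measurable
  -- null set, on which levels are redirected to the good level `s₀`.
  set N := toMeasurable volume {s : I | levelRule q s ∈ thresholdMaximizers F ρ}ᶜ with hN
  have hN0 : volume N = 0 := by
    rw [hN, measure_toMeasurable]
    exact hae
  set k : I → I := fun s => if s ∈ N then s₀ else s with hk
  have hkm : Measurable k :=
    Measurable.ite (measurableSet_toMeasurable _ _) measurable_const measurable_id
  have hkmem : ∀ s, levelRule q (k s) ∈ thresholdMaximizers F ρ := by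
    intro s
    by_cases h : s ∈ N
    · simpa [hk, h] using hs₀
    · have : s ∉ {s : I | levelRule q s ∈ thresholdMaximizers F ρ}ᶜ :=
        fun h' => h (subset_toMeasurable _ _ h')
      simpa [hk, h] using this
  have hgm : Measurable fun s => (⟨levelRule q (k s), hkmem s⟩ : thresholdMaximizers F ρ) :=
    (measurable_pi_lambda _ fun x => (measurable_levelRule q x).comp hkm).subtype_mk
  refine ⟨volume.map _, Measure.isProbabilityMeasure_map hgm.aemeasurable, fun x => ?_⟩
  have hx : Measurable fun q' : thresholdMaximizers F ρ => (q'.1 x : ℝ) :=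
    measurable_subtype_coe.comp (measurable_eval_thresholdMaximizers F ρ x)
  rw [integral_map hgm.aemeasurable hx.aestronglyMeasurable, integral_levelRule]
  refine integral_congr_ae ?_
  filter_upwards [measure_eq_zero_iff_ae_notMem.1 hN0] with s hs
  simp [hk, hs]

theorem IsPointwiseMixture.isBochnerMixture {Λ : Measure (thresholdMaximizers F ρ)}
    [IsProbabilityMeasure Λ] {q : AllocationRule} (hq : q ∈ Attention.feasible)
    (h : IsPointwiseMixture F ρ Λ q) : IsBochnerMixture F ρ Λ q hq :=
  ⟨integrable_toL1 F ρ Λ _ (measurable_eval_thresholdMaximizers F ρ),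
    integral_toL1 F ρ Λ _ (measurable_eval_thresholdMaximizers F ρ) hq h⟩

theorem IsBochnerMixture.mem_maximizers {Λ : Measure (thresholdMaximizers F ρ)}
    [IsProbabilityMeasure Λ] {q : AllocationRule} {hq : q ∈ Attention.feasible}
    (h : IsBochnerMixture F ρ Λ q hq) : q ∈ maximizers F ρ := by
  refine (mem_maximizers_iff F ρ hq).2 fun q' hq' => ?_
  rw [← h.2, ← (attentionFunctional F ρ).integral_comp_comm h.1]
  calc attentionFunctional F ρ (toL1 F ρ q' hq')
      = ∫ _ : thresholdMaximizers F ρ, attentionFunctional F ρ (toL1 F ρ q' hq') ∂Λ := by simp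
    _ ≤ _ := integral_mono (integrable_const _) ((attentionFunctional F ρ).integrable_comp h.1)
        fun p => (mem_maximizers_iff F ρ p.2.2.1).1 p.2.2 q' hq'

end Attention

theorem propositionA1 (F : MeasureTheory.Measure unitInterval)
    [MeasureTheory.IsProbabilityMeasure F]
    (ρ : ProbabilityTheory.Kernel unitInterval unitInterval)
    [ProbabilityTheory.IsMarkovKernel ρ] :
    (∀ (q : Attention.AllocationRule) (hq : q ∈ Attention.feasible),
      q ∈ Attention.maximizers F ρ ↔
        ∃ Λ : MeasureTheory.Measure (Attention.thresholdMaximizers F ρ),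
          MeasureTheory.IsProbabilityMeasure Λ ∧ Attention.IsBochnerMixture F ρ Λ q hq) ∧
    (∀ q : Attention.AllocationRule,
      q ∈ Attention.maximizers F ρ ↔
        ∃ Λ : MeasureTheory.Measure (Attention.thresholdMaximizers F ρ),
          MeasureTheory.IsProbabilityMeasure Λ ∧ Attention.IsPointwiseMixture F ρ Λ q) := by
  refine ⟨fun q hq => ⟨fun h => ?_, ?_⟩, fun q => ⟨Attention.exists_isPointwiseMixture F ρ, ?_⟩⟩
  · obtain ⟨Λ, hΛ, hmix⟩ := Attention.exists_isPointwiseMixture F ρ h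
    exact ⟨Λ, hΛ, hmix.isBochnerMixture F ρ hq⟩
  · rintro ⟨Λ, hΛ, hmix⟩
    exact hmix.mem_maximizers F ρ
  · rintro ⟨Λ, hΛ, hmix⟩
    exact (hmix.isBochnerMixture F ρ (hmix.feasible F ρ)).mem_maximizers F ρ
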